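/- Let $k$ be a field and let $0 \le r \le n$ be integers. Draw the complete bipartite graph $K_{r,n-r}$ in the plane with its vertices $1,\dots,r$ on a vertical line on the left, labelled from bottom to top, its vertices $r+1,\dots,n$ on a vertical line on the right, labelled from top to bottom, and its edges $(i,j)$ ($1\le i\le r<j\le n$) as closed straight line segments. Let $$I=\ker\bigl(k[x_{ij} : 1\le i\le r,\ r+1\le j\le n]\to k[t_1,\dots,t_n],\quad x_{ij}\mapsto t_it_j\bigr)$$ be the toric ideal of $\mathcal B_{r,n}=\{e_i+e_j : 1\le i\le r,\ r+1\le j\le n\}$. Let the weight of the variable $x_{ij}$ be the number of edges of $K_{r,n-r}$ whose segment does not meet the segment of $(i,j)$, and let the weight of a monomial $\prod x_{ij}^{u_{ij}}$ be $\sum u_{ij}\,\mathrm{weight}(x_{ij})$. Let $\succ$ be any term order which refines the partial order on monomials given by the weights, that is, $x^v\succ x^u$ whenever the weight of $x^v$ is larger than the weight of $x^u$. Then the set of binomials $$\mathcal G=\{\,x_{ij}x_{kl}-x_{il}x_{kj} : (i,j),(k,l)\text{ edges of }K_{r,n-r}\text{ whose segments do not meet}\,\}\qquad(1\le i,k\le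 r<j,l\le n)$$ is the reduced Gröbner basis of $I$ with respect to $\succ$: $\mathcal G$ is a finite subset of $I$, the initial monomials of its elements generate the initial ideal of $I$, each of its elements is nonzero with leading coefficient $1$, and no monomial of an element of $\mathcal G$ is divisible by the initial monomial of a different element of $\mathcal G$. -/

import Mathlib

open scoped MonomialOrder

noncomputable section

/-- The vertices of the complete bipartite graph `K_{r,s}`, where `s = n - r`.
`Sum.inl i` stands for the vertex `i + 1 ∈ {1, …, r}` and `Sum.inr j` for the vertex
`r + 1 + j ∈ {r + 1, …, n}`. -/
abbrev Vertex (r s : ℕ) : Type := Fin r ⊕ Fin s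

/-- The edges of `K_{r,s}`; they index the variables `x_{ij}`. -/
abbrev Edge (r s : ℕ) : Type := Fin r × Fin s

/-- A convex drawing of `K_{r,s}`: the `r` vertices of the first class lie on the vertical line
`x = 0` and are labelled from bottom to top, the `s` vertices of the second class lie on the
vertical line `x = 1` and are labelled from top to bottom. -/
structure ConvexDrawing (r s : ℕ) where
  /-- heights of the vertices on the left -/
  left : Fin r → ℝ
  /-- heights of the vertices on the right -/
  right : Fin s → ℝ
  /-- the left vertices are labelled from bottom to top -/
  left_strictMono : StrictMono left
  /-- the right vertices are labelled from top to bottom -/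
  right_strictAnti : StrictAnti right

namespace ConvexDrawing

variable {r s : ℕ} (D : ConvexDrawing r s)

/-- The point of the plane at which a vertex is drawn. -/
def point : Vertex r s → ℝ × ℝ
  | Sum.inl i => (0, D.left i)
  | Sum.inr j => (1, D.right j)

/-- The closed line segment that represents an edge. -/
def edgeSegment (e : Edge r s) : Set (ℝ × ℝ) :=
  segment ℝ (D.point (Sum.inl e.1)) (D.point (Sum.inr e.2))

/-- Two edges are non-crossing if their closed segments do not meet (not even in an endpoint). -/
def NonMeeting (e f : Edge r s) : Prop :=
  Disjoint (D.edgeSegment e) (D.edgeSegment f)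

/-- The weight of the variable of the edge `e`: the number of edges which do not meet `e`. -/
def edgeWeight (e : Edge r s) : ℕ :=
  {f : Edge r s | D.NonMeeting e f}.ncard

/-- The weight of the monomial with exponent vector `u`, that is `∑ e, u e * edgeWeight e`. -/
def monomialWeight (u : Edge r s →₀ ℕ) : ℕ :=
  Finsupp.weight D.edgeWeight u

/-- The term order `m` refines the partial order on monomials that is given by the weights. -/
def IsRefinedBy (m : MonomialOrder (Edge r s)) : Prop :=
  ∀ u v : Edge r s →₀ ℕ, D.monomialWeight u < D.monomialWeight v → u ≺[m] v

/-- The set of all binomials `x_{ij} x_{kl} - x_{il} x_{kj}`, where `(i,j)` and `(k,l)` are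
edges which do not meet. -/
def binomials (k : Type*) [Field k] : Set (MvPolynomial (Edge r s) k) :=
  {p | ∃ e f : Edge r s, D.NonMeeting e f ∧
    p = MvPolynomial.X e * MvPolynomial.X f
      - MvPolynomial.X (e.1, f.2) * MvPolynomial.X (f.1, e.2)}

end ConvexDrawing

/-- The toric ideal of `B_{r,n} = {e_i + e_j | 1 ≤ i ≤ r, r + 1 ≤ j ≤ n}`: the kernel of the
`k`-algebra homomorphism `x_{ij} ↦ t_i t_j`. -/
def toricIdeal (k : Type*) [Field k] (r s : ℕ) : Ideal (MvPolynomial (Edge r s) k) :=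
  RingHom.ker (MvPolynomial.aeval (R := k) (fun e : Edge r s =>
    (MvPolynomial.X (Sum.inl e.1) * MvPolynomial.X (Sum.inr e.2) :
      MvPolynomial (Vertex r s) k)))

/-- The ideal generated by the initial monomials of the nonzero elements of a set `S`. -/
def initialIdeal {σ k : Type*} [Field k] (m : MonomialOrder σ) (S : Set (MvPolynomial σ k)) :
    Ideal (MvPolynomial σ k) :=
  Ideal.span {q | ∃ p ∈ S, p ≠ 0 ∧ q = MvPolynomial.monomial (m.degree p) 1}

/-- `G` is a Gröbner basis of the ideal `I` with respect to the term order `m`: a finite subset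
of `I` whose initial monomials generate the initial ideal of `I`. -/
structure IsGroebnerBasis {σ k : Type*} [Field k] (m : MonomialOrder σ)
    (G : Set (MvPolynomial σ k)) (I : Ideal (MvPolynomial σ k)) : Prop where
  finite : G.Finite
  subset : G ⊆ I
  initialIdeal_eq : initialIdeal m G = initialIdeal m (I : Set (MvPolynomial σ k))

/-- `G` is the reduced Gröbner basis of `I`: a Gröbner basis without zero whose elements have
leading coefficient `1`, and such that no monomial of an element of `G` is divisible by the
initial monomial of another element of `G`. -/
structure IsReducedGroebnerBasis {σ k : Type*} [Field k] (m : MonomialOrder σ)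
    (G : Set (MvPolynomial σ k)) (I : Ideal (MvPolynomial σ k)) : Prop
    extends IsGroebnerBasis m G I where
  zero_notMem : 0 ∉ G
  monic : ∀ g ∈ G, m.leadingCoeff g = 1
  reduced : ∀ g ∈ G, ∀ h ∈ G, g ≠ h → ∀ u ∈ h.support, ¬ m.degree g ≤ u

end

/-! ### Crossings, edge weights and initial monomials of the binomials -/

namespace ConvexDrawing

variable {r s : ℕ} (D : ConvexDrawing r s)

/-! Because the two sides are labelled in opposite directions, two edges meet exactly when they are
comparable in the product order on labels (`nonMeeting_iff`). Uncrossed pairs have larger total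
weight than the crossed pairs replacing them (`edgeWeight_exchange_lt`), so `x_e x_f` is the initial
monomial of its binomial. Monomials divisible by no such product are those supported on a chain. A
chain monomial is determined by its multidegree, by the northwest corner rule
(`IsStandard.eq_of_multidegree_eq`), and every monomial reduces to one without increasing
(`exists_isStandard_le`). Hence a chain monomial is the least of its multidegree and cannot lead an
element of the toric ideal (`not_isStandard_degree`). -/

theorem mem_edgeSegment {e : Edge r s} {p : ℝ × ℝ} :
    p ∈ D.edgeSegment e ↔ 0 ≤ p.1 ∧ p.1 ≤ 1 ∧ p.2 = (1 - p.1) * D.left e.1 + p.1 * D.right e.2 := by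
  obtain ⟨x, y⟩ := p
  simp only [edgeSegment, segment_eq_image, point, Set.mem_image, Set.mem_Icc, Prod.smul_mk,
    Prod.mk_add_mk, Prod.mk.injEq, smul_eq_mul, mul_zero, mul_one, zero_add]
  constructor
  · rintro ⟨t, ⟨h0, h1⟩, rfl, rfl⟩
    exact ⟨h0, h1, rfl⟩
  · rintro ⟨h0, h1, rfl⟩
    exact ⟨x, ⟨h0, h1⟩, rfl, rfl⟩

theorem nonMeeting_symm {e f : Edge r s} (h : D.NonMeeting e f) : D.NonMeeting f e :=
  Disjoint.symm h

/-- The height difference of the two segments changes sign between the two lines, so it vanishes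
somewhere by the intermediate value theorem. -/
theorem not_nonMeeting_of_le {e f : Edge r s} (h₁ : D.left e.1 ≤ D.left f.1)
    (h₂ : D.right f.2 ≤ D.right e.2) : ¬ D.NonMeeting e f := by
  obtain ⟨t, ht0, ht1, ht⟩ : ∃ t : ℝ, 0 ≤ t ∧ t ≤ 1 ∧
      (1 - t) * D.left e.1 + t * D.right e.2 = (1 - t) * D.left f.1 + t * D.right f.2 := by
    have hc : ContinuousOn (fun t : ℝ => (1 - t) * (D.left f.1 - D.left e.1)
        + t * (D.right f.2 - D.right e.2)) (Set.Icc 0 1) := by fun_prop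
    obtain ⟨t, ht, h⟩ := intermediate_value_Icc' zero_le_one hc
      (show (0 : ℝ) ∈ _ by constructor <;> simp <;> linarith)
    exact ⟨t, ht.1, ht.2, by simp only at h; linarith⟩
  refine Set.not_disjoint_iff.2
    ⟨(t, (1 - t) * D.left e.1 + t * D.right e.2), D.mem_edgeSegment.2 ⟨ht0, ht1, rfl⟩,
      D.mem_edgeSegment.2 ⟨ht0, ht1, ht⟩⟩

theorem nonMeeting_of_lt {e f : Edge r s} (h₁ : e.1 < f.1) (h₂ : f.2 < e.2) :
    D.NonMeeting e f := by
  refine Set.disjoint_left.2 fun p he hf => ?_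
  obtain ⟨h0, h1, he⟩ := D.mem_edgeSegment.1 he
  obtain ⟨-, -, hf⟩ := D.mem_edgeSegment.1 hf
  have ha : 0 < D.left f.1 - D.left e.1 := sub_pos.2 (D.left_strictMono h₁)
  have hb : 0 < D.right f.2 - D.right e.2 := sub_pos.2 (D.right_strictAnti h₂)
  have h : (1 - p.1) * (D.left f.1 - D.left e.1) + p.1 * (D.right f.2 - D.right e.2) = 0 := by
    linarith
  rcases h0.eq_or_lt with h0 | h0
  · rw [← h0] at h
    linarith
  · nlinarith [mul_pos h0 hb, mul_nonneg (sub_nonneg.2 h1) ha.le]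

/-- Two edges do not meet if and only if one of them lies strictly below the other one. -/
theorem nonMeeting_iff {e f : Edge r s} :
    D.NonMeeting e f ↔ (e.1 < f.1 ∧ f.2 < e.2) ∨ (f.1 < e.1 ∧ e.2 < f.2) := by
  constructor
  · intro h
    have hl := D.left_strictMono.le_iff_le (a := e.1) (b := f.1)
    have hl' := D.left_strictMono.le_iff_le (a := f.1) (b := e.1)
    have hr := D.right_strictAnti.le_iff_ge (a := e.2) (b := f.2)
    have hr' := D.right_strictAnti.le_iff_ge (a := f.2) (b := e.2)
    have k₁ : ¬ (e.1 ≤ f.1 ∧ e.2 ≤ f.2) := fun hh =>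
      D.not_nonMeeting_of_le (hl.2 hh.1) (hr'.2 hh.2) h
    have k₂ : ¬ (f.1 ≤ e.1 ∧ f.2 ≤ e.2) := fun hh =>
      D.not_nonMeeting_of_le (hl'.2 hh.1) (hr.2 hh.2) (D.nonMeeting_symm h)
    omega
  · rintro (h | h)
    · exact D.nonMeeting_of_lt h.1 h.2
    · exact D.nonMeeting_symm (D.nonMeeting_of_lt h.1 h.2)

theorem edgeWeight_eq (e : Edge r s) :
    D.edgeWeight e = (r - 1 - (e.1 : ℕ)) * e.2 + e.1 * (s - 1 - (e.2 : ℕ)) := by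
  have h : {f : Edge r s | D.NonMeeting e f} =
      ↑((Finset.Ioi e.1 ×ˢ Finset.Iio e.2) ∪ (Finset.Iio e.1 ×ˢ Finset.Ioi e.2)) := by
    ext f
    simp [D.nonMeeting_iff]
  rw [edgeWeight, h, Set.ncard_coe_finset, Finset.card_union_of_disjoint]
  · simp
  · rw [Finset.disjoint_left]
    intro f hf hf'
    simp only [Finset.mem_product, Finset.mem_Ioi, Finset.mem_Iio] at hf hf'
    exact lt_asymm hf.1 hf'.1

theorem edgeWeight_cast (e : Edge r s) : (D.edgeWeight e : ℤ) =
    (r - 1 - (e.1 : ℤ)) * (e.2 : ℤ) + (e.1 : ℤ) * (s - 1 - (e.2 : ℤ)) := by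
  -- Nothing is truncated, since `e.1 < r` and `e.2 < s`.
  have h₁ : ((r - 1 - (e.1 : ℕ) : ℕ) : ℤ) = r - 1 - (e.1 : ℤ) := by omega
  have h₂ : ((s - 1 - (e.2 : ℕ) : ℕ) : ℤ) = s - 1 - (e.2 : ℤ) := by omega
  rw [D.edgeWeight_eq, Nat.cast_add, Nat.cast_mul, Nat.cast_mul, h₁, h₂]

/-- The weight of `(i, j)` is `-2ij` plus terms separate in `i` and `j`. The separate terms cancel,
and the difference of the two sides is twice the product in `key`. -/
theorem edgeWeight_exchange_lt {e f : Edge r s} (h : D.NonMeeting e f) :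
    D.edgeWeight (e.1, f.2) + D.edgeWeight (f.1, e.2) < D.edgeWeight e + D.edgeWeight f := by
  have key : (0 : ℤ) < ((f.1 : ℤ) - e.1) * ((e.2 : ℤ) - f.2) := by
    rcases D.nonMeeting_iff.1 h with ⟨h₁, h₂⟩ | ⟨h₁, h₂⟩
    · exact mul_pos (by omega) (by omega)
    · exact mul_pos_of_neg_of_neg (by omega) (by omega)
  zify
  simp only [D.edgeWeight_cast]
  linarith

theorem exchange_lt {m : MonomialOrder (Edge r s)} (hm : D.IsRefinedBy m) {e f : Edge r s}
    (h : D.NonMeeting e f) :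
    (Finsupp.single (e.1, f.2) 1 + Finsupp.single (f.1, e.2) 1) ≺[m]
      (Finsupp.single e 1 + Finsupp.single f 1) := by
  apply hm
  simpa [monomialWeight, Finsupp.weight_single] using D.edgeWeight_exchange_lt h

theorem NonMeeting.ne {D : ConvexDrawing r s} {e f : Edge r s} (h : D.NonMeeting e f) :
    e ≠ f := by
  rintro rfl
  simpa using D.nonMeeting_iff.1 h

theorem binomial_eq_monomial (k : Type*) [Field k] (e f : Edge r s) :
    (MvPolynomial.X e * MvPolynomial.X f
      - MvPolynomial.X (e.1, f.2) * MvPolynomial.X (f.1, e.2) : MvPolynomial (Edge r s) k) =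
    MvPolynomial.monomial (Finsupp.single e 1 + Finsupp.single f 1) 1 -
      MvPolynomial.monomial (Finsupp.single (e.1, f.2) 1 + Finsupp.single (f.1, e.2) 1) 1 := by
  simp [MvPolynomial.X, MvPolynomial.monomial_mul]

theorem degree_binomial {k : Type*} [Field k] {m : MonomialOrder (Edge r s)}
    (hm : D.IsRefinedBy m) {e f : Edge r s} (h : D.NonMeeting e f) :
    m.degree (MvPolynomial.X e * MvPolynomial.X f
      - MvPolynomial.X (e.1, f.2) * MvPolynomial.X (f.1, e.2) : MvPolynomial (Edge r s) k) =
    Finsupp.single e 1 + Finsupp.single f 1 := by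
  classical
  rw [binomial_eq_monomial, MonomialOrder.degree_sub_of_lt]
  · simp [MonomialOrder.degree_monomial]
  · simpa [MonomialOrder.degree_monomial] using D.exchange_lt hm h

theorem leadingCoeff_binomial {k : Type*} [Field k] {m : MonomialOrder (Edge r s)}
    (hm : D.IsRefinedBy m) {e f : Edge r s} (h : D.NonMeeting e f) :
    m.leadingCoeff (MvPolynomial.X e * MvPolynomial.X f
      - MvPolynomial.X (e.1, f.2) * MvPolynomial.X (f.1, e.2) : MvPolynomial (Edge r s) k) = 1 := by
  classical
  rw [binomial_eq_monomial, MonomialOrder.leadingCoeff_sub_of_lt]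
  · simp
  · simpa [MonomialOrder.degree_monomial] using D.exchange_lt hm h

end ConvexDrawing

/-! ### The multigrading and the toric ideal -/

section Multidegree

variable {r s : ℕ}

/-- The exponent vector of the image of the monomial with exponent vector `u` under
`x_{ij} ↦ t_i t_j`. -/
noncomputable def multidegree (r s : ℕ) : (Edge r s →₀ ℕ) →+ (Vertex r s →₀ ℕ) :=
  Finsupp.weight fun e => Finsupp.single (Sum.inl e.1) 1 + Finsupp.single (Sum.inr e.2) 1

theorem multidegree_single (e : Edge r s) :
    multidegree r s (Finsupp.single e 1) =
      Finsupp.single (Sum.inl e.1) 1 + Finsupp.single (Sum.inr e.2) 1 := by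
  simp [multidegree, Finsupp.weight_single]

theorem multidegree_exchange (e f : Edge r s) :
    multidegree r s (Finsupp.single (e.1, f.2) 1 + Finsupp.single (f.1, e.2) 1) =
      multidegree r s (Finsupp.single e 1 + Finsupp.single f 1) := by
  simp only [map_add, multidegree_single]
  abel

theorem multidegree_apply (u : Edge r s →₀ ℕ) (v : Vertex r s) :
    multidegree r s u v = ∑ e, u e * ((Finsupp.single (Sum.inl e.1) 1 : Vertex r s →₀ ℕ) v +
      (Finsupp.single (Sum.inr e.2) 1 : Vertex r s →₀ ℕ) v) := by
  simp only [multidegree, Finsupp.weight_eq_sum, Finsupp.finsetSum_apply, Finsupp.smul_apply,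
    Finsupp.add_apply, smul_eq_mul]

theorem multidegree_inl_ne_zero {u : Edge r s →₀ ℕ} {i : Fin r} :
    multidegree r s u (Sum.inl i) ≠ 0 ↔ ∃ j, u (i, j) ≠ 0 := by
  classical
  simp [multidegree_apply, Finsupp.single_apply, Finset.sum_eq_zero_iff]

theorem multidegree_inr_ne_zero {u : Edge r s →₀ ℕ} {j : Fin s} :
    multidegree r s u (Sum.inr j) ≠ 0 ↔ ∃ i, u (i, j) ≠ 0 := by
  classical
  simp [multidegree_apply, Finsupp.single_apply, Finset.sum_eq_zero_iff]

theorem multidegree_eq_zero {u : Edge r s →₀ ℕ} : multidegree r s u = 0 ↔ u = 0 := by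
  refine ⟨fun h => ?_, fun h => by rw [h, map_zero]⟩
  ext ⟨i, j⟩
  by_contra hu
  exact multidegree_inl_ne_zero.2 ⟨j, hu⟩ (by rw [h]; rfl)

theorem aeval_monomial_toric (k : Type*) [Field k] (u : Edge r s →₀ ℕ) (c : k) :
    MvPolynomial.aeval (R := k) (fun e : Edge r s =>
      (MvPolynomial.X (Sum.inl e.1) * MvPolynomial.X (Sum.inr e.2) :
        MvPolynomial (Vertex r s) k)) (MvPolynomial.monomial u c) =
      MvPolynomial.monomial (multidegree r s u) c := by
  rw [MvPolynomial.aeval_monomial, multidegree, Finsupp.weight_apply,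
    MvPolynomial.monomial_finsupp_sum_index, MvPolynomial.algebraMap_eq]
  congr 1
  refine Finsupp.prod_congr fun e _ => ?_
  rw [MvPolynomial.X, MvPolynomial.X, MvPolynomial.monomial_mul, MvPolynomial.monomial_pow,
    one_mul, one_pow]

/-- Monomials map to monomials, so a term alone in its multidegree would survive in the image. -/
theorem exists_ne_mem_support_of_mem_toricIdeal {k : Type*} [Field k]
    {p : MvPolynomial (Edge r s) k} (hp : p ∈ toricIdeal k r s) {u : Edge r s →₀ ℕ}
    (hu : u ∈ p.support) :
    ∃ v ∈ p.support, v ≠ u ∧ multidegree r s v = multidegree r s u := by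
  classical
  by_contra! hne
  rw [toricIdeal, RingHom.mem_ker, p.as_sum, map_sum] at hp
  have h := congrArg (MvPolynomial.coeff (multidegree r s u)) hp
  simp only [aeval_monomial_toric, MvPolynomial.coeff_sum, MvPolynomial.coeff_monomial,
    MvPolynomial.coeff_zero] at h
  rw [Finset.sum_eq_single_of_mem u hu fun v hv hvu => if_neg (hne v hv hvu), if_pos rfl] at h
  exact MvPolynomial.mem_support_iff.1 hu h

theorem binomial_mem_toricIdeal (k : Type*) [Field k] (e f : Edge r s) :
    (MvPolynomial.X e * MvPolynomial.X f
      - MvPolynomial.X (e.1, f.2) * MvPolynomial.X (f.1, e.2) : MvPolynomial (Edge r s) k) ∈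
      toricIdeal k r s := by
  rw [toricIdeal, RingHom.mem_ker]
  simp only [map_sub, map_mul, MvPolynomial.aeval_X]
  ring

end Multidegree

/-! ### Standard monomials -/

namespace ConvexDrawing

variable {r s : ℕ} (D : ConvexDrawing r s)

/-- An exponent vector is standard if any two edges of its support meet. -/
def IsStandard (u : Edge r s →₀ ℕ) : Prop :=
  ∀ e ∈ u.support, ∀ f ∈ u.support, ¬ D.NonMeeting e f

variable {D}

theorem single_add_single_le {u : Edge r s →₀ ℕ} {e f : Edge r s} (he : e ∈ u.support)
    (hf : f ∈ u.support) (hef : e ≠ f) : Finsupp.single e 1 + Finsupp.single f 1 ≤ u := by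
  classical
  intro g
  rw [Finsupp.mem_support_iff] at he hf
  simp only [Finsupp.add_apply, Finsupp.single_apply]
  split_ifs with h₁ h₂ h₂
  · exact absurd (h₁.trans h₂.symm) hef
  · subst h₁; omega
  · subst h₂; omega
  · omega

theorem IsStandard.mono {u v : Edge r s →₀ ℕ} (hu : D.IsStandard u) (h : v ≤ u) :
    D.IsStandard v := fun e he f hf =>
  hu e (Finsupp.support_mono h he) f (Finsupp.support_mono h hf)

/-- A standard exponent vector contains the edge between the first left vertex and the first
right vertex that its multidegree involves. -/
theorem IsStandard.corner_ne_zero {u : Edge r s →₀ ℕ} (hu : D.IsStandard u) {i : Fin r} {j : Fin s}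
    (hi : multidegree r s u (Sum.inl i) ≠ 0) (hj : multidegree r s u (Sum.inr j) ≠ 0)
    (hi' : ∀ i', multidegree r s u (Sum.inl i') ≠ 0 → i ≤ i')
    (hj' : ∀ j', multidegree r s u (Sum.inr j') ≠ 0 → j ≤ j') : u (i, j) ≠ 0 := by
  obtain ⟨l, hl⟩ := multidegree_inl_ne_zero.1 hi
  obtain ⟨k, hk⟩ := multidegree_inr_ne_zero.1 hj
  have hjl := hj' l (multidegree_inr_ne_zero.2 ⟨i, hl⟩)
  have hik := hi' k (multidegree_inl_ne_zero.2 ⟨j, hk⟩)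
  -- If both inequalities are strict, `(i, l)` and `(k, j)` do not meet.
  rcases hjl.eq_or_lt with rfl | hjl
  · exact hl
  rcases hik.eq_or_lt with rfl | hik
  · exact hk
  exact absurd (D.nonMeeting_iff.2 (Or.inl ⟨hik, hjl⟩))
    (hu (i, l) (Finsupp.mem_support_iff.2 hl) (k, j) (Finsupp.mem_support_iff.2 hk))

/-- A standard exponent vector is determined by its multidegree. -/
theorem IsStandard.eq_of_multidegree_eq {u v : Edge r s →₀ ℕ} (hu : D.IsStandard u)
    (hv : D.IsStandard v) (h : multidegree r s u = multidegree r s v) : u = v := by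
  classical
  induction hn : u.degree using Nat.strong_induction_on generalizing u v with
  | _ n ih =>
    by_cases hu0 : u = 0
    · subst hu0
      rw [map_zero] at h
      exact (multidegree_eq_zero.1 h.symm).symm
    obtain ⟨⟨a, b⟩, hab⟩ := Finsupp.ne_iff.1 hu0
    have hI : (Finset.univ.filter fun i => multidegree r s u (Sum.inl i) ≠ 0).Nonempty :=
      ⟨a, by simpa using multidegree_inl_ne_zero.2 ⟨b, hab⟩⟩
    have hJ : (Finset.univ.filter fun j => multidegree r s u (Sum.inr j) ≠ 0).Nonempty :=
      ⟨b, by simpa using multidegree_inr_ne_zero.2 ⟨a, hab⟩⟩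
    obtain ⟨i, hi, hi'⟩ := Finset.exists_min_image _ id hI
    obtain ⟨j, hj, hj'⟩ := Finset.exists_min_image _ id hJ
    simp only [Finset.mem_filter_univ, id] at hi hi' hj hj'
    have h₁ := hu.corner_ne_zero hi hj hi' hj'
    -- The corner depends only on the multidegree, so `u` and `v` share it; removing it from both
    -- lowers the degree.
    rw [h] at hi hi' hj hj'
    have h₂ := hv.corner_ne_zero hi hj hi' hj'
    have hu₁ : Finsupp.single (i, j) 1 ≤ u := Finsupp.single_le_iff.2 (Nat.one_le_iff_ne_zero.2 h₁)
    have hv₁ : Finsupp.single (i, j) 1 ≤ v := Finsupp.single_le_iff.2 (Nat.one_le_iff_ne_zero.2 h₂)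
    obtain ⟨u', rfl⟩ := exists_add_of_le hu₁
    obtain ⟨v', rfl⟩ := exists_add_of_le hv₁
    rw [map_add, map_add] at h
    rw [ih u'.degree (by rw [← hn, map_add, Finsupp.degree_single]; omega)
      (hu.mono le_add_self) (hv.mono le_add_self) (add_left_cancel h) rfl]

/-- Every exponent vector can be reduced to a standard one of the same multidegree. -/
theorem exists_isStandard_le {m : MonomialOrder (Edge r s)} (hm : D.IsRefinedBy m)
    (u : Edge r s →₀ ℕ) :
    ∃ v, D.IsStandard v ∧ v ≼[m] u ∧ multidegree r s v = multidegree r s u := by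
  induction hw : m.toSyn u using WellFoundedLT.induction generalizing u with
  | _ w ih =>
    by_cases hu : D.IsStandard u
    · exact ⟨u, hu, hw.le, rfl⟩
    · simp only [IsStandard, not_forall, not_not] at hu
      obtain ⟨e, he, f, hf, h⟩ := hu
      obtain ⟨u', rfl⟩ := exists_add_of_le (single_add_single_le he hf h.ne)
      have hlt : m.toSyn (Finsupp.single (e.1, f.2) 1 + Finsupp.single (f.1, e.2) 1 + u') < w := by
        rw [← hw, map_add _ _ u', map_add _ _ u']
        exact add_lt_add_left (D.exchange_lt hm h) _
      obtain ⟨v, hv, hle, heq⟩ := ih _ hlt _ rfl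
      refine ⟨v, hv, hle.trans hlt.le, ?_⟩
      rw [heq, map_add _ _ u', map_add _ _ u', multidegree_exchange]

/-- Some smaller term `v` has the same multidegree as the leading one. Its standard reduction is at
most `v`, yet by uniqueness would be the leading exponent itself. -/
theorem not_isStandard_degree {k : Type*} [Field k] {m : MonomialOrder (Edge r s)}
    (hm : D.IsRefinedBy m) {p : MvPolynomial (Edge r s) k} (hp : p ∈ toricIdeal k r s)
    (hp0 : p ≠ 0) : ¬ D.IsStandard (m.degree p) := by
  intro hst
  obtain ⟨v, hv, hne, heq⟩ := exists_ne_mem_support_of_mem_toricIdeal hp (m.degree_mem_support hp0)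
  have hlt : v ≺[m] m.degree p :=
    (m.le_degree hv).lt_of_ne fun h => hne (m.toSyn.injective h)
  obtain ⟨w, hw, hwv, hweq⟩ := exists_isStandard_le hm v
  have := hw.eq_of_multidegree_eq hst (hweq.trans heq)
  subst this
  exact absurd hlt (not_lt_of_ge hwv)

/-! ### The reduced Gröbner basis -/

theorem binomials_finite (k : Type*) [Field k] : (D.binomials k).Finite := by
  refine (Set.finite_range fun q : Edge r s × Edge r s =>
    (MvPolynomial.X q.1 * MvPolynomial.X q.2 - MvPolynomial.X (q.1.1, q.2.2) *
      MvPolynomial.X (q.2.1, q.1.2) : MvPolynomial (Edge r s) k)).subset ?_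
  rintro _ ⟨e, f, -, rfl⟩
  exact ⟨(e, f), rfl⟩

theorem binomials_subset (k : Type*) [Field k] :
    D.binomials k ⊆ (toricIdeal k r s : Set (MvPolynomial (Edge r s) k)) := by
  rintro _ ⟨e, f, -, rfl⟩
  exact binomial_mem_toricIdeal k e f

theorem leadingCoeff_eq_one_of_mem_binomials {k : Type*} [Field k] {m : MonomialOrder (Edge r s)}
    (hm : D.IsRefinedBy m) {g : MvPolynomial (Edge r s) k} (hg : g ∈ D.binomials k) :
    m.leadingCoeff g = 1 := by
  obtain ⟨e, f, h, rfl⟩ := hg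
  exact D.leadingCoeff_binomial hm h

theorem ne_zero_of_mem_binomials {k : Type*} [Field k] {m : MonomialOrder (Edge r s)}
    (hm : D.IsRefinedBy m) {g : MvPolynomial (Edge r s) k} (hg : g ∈ D.binomials k) : g ≠ 0 := by
  rintro rfl
  simpa using leadingCoeff_eq_one_of_mem_binomials hm hg

theorem initialIdeal_binomials {k : Type*} [Field k] {m : MonomialOrder (Edge r s)}
    (hm : D.IsRefinedBy m) :
    initialIdeal m (D.binomials k) =
      initialIdeal m (toricIdeal k r s : Set (MvPolynomial (Edge r s) k)) := by
  apply le_antisymm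
  · apply Ideal.span_mono
    rintro q ⟨p, hp, h⟩
    exact ⟨p, binomials_subset k hp, h⟩
  · refine Ideal.span_le.2 ?_
    rintro _ ⟨p, hp, hp0, rfl⟩
    have hst := not_isStandard_degree hm hp hp0
    simp only [IsStandard, not_forall, not_not] at hst
    obtain ⟨e, he, f, hf, h⟩ := hst
    obtain ⟨u, hu⟩ := exists_add_of_le (single_add_single_le he hf h.ne)
    have hmem : (_ : MvPolynomial (Edge r s) k) ∈ D.binomials k := ⟨e, f, h, rfl⟩
    have hgen : MvPolynomial.monomial (Finsupp.single e 1 + Finsupp.single f 1) (1 : k) ∈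
        initialIdeal m (D.binomials k) :=
      Ideal.subset_span ⟨_, hmem, ne_zero_of_mem_binomials hm hmem, by
        rw [D.degree_binomial hm h]⟩
    rw [hu, SetLike.mem_coe, ← one_mul (1 : k), ← MvPolynomial.monomial_mul]
    exact Ideal.mul_mem_right _ _ hgen

theorem mem_of_single_add_single_le {e f a b : Edge r s}
    (h : (Finsupp.single e 1 + Finsupp.single f 1 : Edge r s →₀ ℕ) ≤
      Finsupp.single a 1 + Finsupp.single b 1) : (e = a ∨ e = b) ∧ (f = a ∨ f = b) := by
  classical
  have h₁ := h e
  have h₂ := h f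
  simp only [Finsupp.add_apply, Finsupp.single_apply] at h₁ h₂
  constructor
  · by_contra! hne
    simp [hne.1.symm, hne.2.symm] at h₁
  · by_contra! hne
    simp [hne.1.symm, hne.2.symm] at h₂

theorem binomials_reduced {k : Type*} [Field k] {m : MonomialOrder (Edge r s)}
    (hm : D.IsRefinedBy m) {g h : MvPolynomial (Edge r s) k} (hg : g ∈ D.binomials k)
    (hh : h ∈ D.binomials k) (hne : g ≠ h) {u : Edge r s →₀ ℕ} (hu : u ∈ h.support) :
    ¬ m.degree g ≤ u := by
  classical
  intro hle
  obtain ⟨e, f, hef, rfl⟩ := hg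
  obtain ⟨a, b, hab, rfl⟩ := hh
  rw [D.degree_binomial hm hef] at hle
  rw [binomial_eq_monomial] at hu
  have hu' := MvPolynomial.support_sub _ _ _ hu
  rw [Finset.mem_union] at hu'
  rcases hu' with hu' | hu' <;>
    rw [Finset.mem_singleton.1 (MvPolynomial.support_monomial_subset hu')] at hle <;>
    obtain ⟨he, hf⟩ := mem_of_single_add_single_le hle
  · rcases he with rfl | rfl <;> rcases hf with rfl | rfl
    · exact hef.ne rfl
    · exact hne rfl
    -- Swapping `e` and `f` gives the same binomial.
    · exact hne (by ring)
    · exact hef.ne rfl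
  -- The edges `(a.1, b.2)` and `(b.1, a.2)` of the trailing monomial are comparable, so no
  -- non-meeting pair lies among them.
  · have h₁ := D.nonMeeting_iff.1 hef
    have h₂ := D.nonMeeting_iff.1 hab
    rcases he with rfl | rfl <;> rcases hf with rfl | rfl <;> simp only at h₁ <;> omega

end ConvexDrawing

theorem theorem3 {k : Type*} [Field k] (r s : ℕ) (D : ConvexDrawing r s)
    (m : MonomialOrder (Edge r s)) (hm : D.IsRefinedBy m) :
    IsReducedGroebnerBasis m (D.binomials k) (toricIdeal k r s) where
  finite := ConvexDrawing.binomials_finite k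
  subset := ConvexDrawing.binomials_subset k
  initialIdeal_eq := ConvexDrawing.initialIdeal_binomials hm
  zero_notMem h := ConvexDrawing.ne_zero_of_mem_binomials hm h rfl
  monic _ := ConvexDrawing.leadingCoeff_eq_one_of_mem_binomials hm
  reduced _ hg _ hh hne _ := ConvexDrawing.binomials_reduced hm hg hh hne
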